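/- Let $\mathscr D$ be a b-quad-graph, that is, a strongly regular cell decomposition into quadrilaterals whose vertices are coloured white and black such that every edge joins a white and a black vertex, and suppose all its vertices are interior. Let $G$ be the graph whose vertices are the white vertices and whose edges are the faces of $\mathscr D$, each face joining its two white vertices. Let $\alpha$ be an admissible labelling: $\alpha(f)\in(0,\pi)$ for every face $f$, and $\sum_{f\ni b}\alpha(f)=2\pi$ for every black vertex $b$. Let $\mathscr C$ be an embedded circle pattern for $\mathscr D$ and $\alpha$: to each white vertex $v$ is assigned a circle with centre $c(v)$ and radius $r(v)>0$, and to each black vertex a point of $\mathbb C$, such that for every face $f$ with white vertices $v_0,v_1$ the circles of $v_0$ and $v_1$ meet in the two distinct points assigned to the black vertices of $f$, with exterior intersection angle $\alpha(f)$ (the angle, at either intersection point, of the closed kite $K_f$ spanned by the two centres and the two intersection points). Kites of distinct faces have disjoint interiors and intersect exactly in the vertex or straight edge corresponding to the common vertex or edge of the two faces, and not at all if there is none. Kites need not be convex. Assume that the kites cover the whole plane $\mathbb C$ and that the pattern is locally finite, i.e. every compact subset of $\mathbb C$ meets only finitely many kites. For $0<\theta<\pi$ let $f_\theta(x)=\frac1{2i}\log\frac{1-e^{x-i\theta}}{1-e^{x+i\theta}}$,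 with the branch of the logarithm such that $0<f_\theta(x)<\pi$. Then the network on $G$ with conductances $$\mu([v_0,v_1])=2f'_{\alpha([v_0,v_1])}\bigl(\log r(v_1)-\log r(v_0)\bigr)$$ is recurrent: for every vertex $v$ of $G$, the random walk on $G$ started at $v$ that jumps from $x$ to a neighbour $y$ with probability $\mu([x,y])/\sum_{z\sim x}\mu([x,z])$ returns to $v$ with probability one. -/

import Mathlib

open scoped ENNReal

noncomputable section

/-- The combinatorics of a paving by quadrilaterals whose vertices are coloured white (`W`) and
black (`B`) such that every edge joins a white vertex to a black one. Every face `f : F` is a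
quadrilateral with the vertices `white₁ f, black₁ f, white₂ f, black₂ f` in this cyclic order, so
its edges are the four pairs consisting of a white and a black vertex of `f`. The numbering of the
two white and of the two black vertices of a face carries no information.
The paving is a strongly regular cell decomposition: distinct faces have at most a vertex
or an edge in common. -/
structure BQuadGraph (W B F : Type*) where
  white₁ : F → W
  white₂ : F → W
  black₁ : F → B
  black₂ : F → B
  white_ne : ∀ f, white₁ f ≠ white₂ f
  black_ne : ∀ f, black₁ f ≠ black₂ f
  white_regular : ∀ f g, f ≠ g →
    (({white₁ f, white₂ f} : Set W) ∩ {white₁ g, white₂ g}).Subsingleton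
  black_regular : ∀ f g, f ≠ g →
    (({black₁ f, black₂ f} : Set B) ∩ {black₁ g, black₂ g}).Subsingleton
  white_incident : ∀ w, ∃ f, w = white₁ f ∨ w = white₂ f
  black_incident : ∀ b, ∃ f, b = black₁ f ∨ b = black₂ f

namespace BQuadGraph

variable {W B F : Type*} (D : BQuadGraph W B F)

/-- The white vertices of a face. -/
def whites (f : F) : Set W := {D.white₁ f, D.white₂ f}

/-- The black vertices of a face. -/
def blacks (f : F) : Set B := {D.black₁ f, D.black₂ f}

/-- The face `f`, seen as an edge of the graph `G` of white vertices, joins `x` and `y`. -/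
def Joins (f : F) (x y : W) : Prop :=
  (x = D.white₁ f ∧ y = D.white₂ f) ∨ (x = D.white₂ f ∧ y = D.white₁ f)

/-- Admissible labelling `α : F → (0, π)` of a paving all of whose black vertices are interior
(as for a paving of the whole plane): the labels around each black vertex add up to `2π`. -/
structure IsAdmissible (α : F → ℝ) : Prop where
  pos : ∀ f, 0 < α f
  lt_pi : ∀ f, α f < Real.pi
  sum_eq : ∀ b : B, HasSum (fun f : {f : F // b ∈ D.blacks f} => α f) (2 * Real.pi)

end BQuadGraph

/-- The closed kite with centres `c₁, c₂` and intersection points `p₁, p₂`, convex or not: the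
union of the two triangles into which the symmetry axis `c₁c₂` cuts it. -/
def closedKite (c₁ c₂ p₁ p₂ : ℂ) : Set ℂ :=
  convexHull ℝ {c₁, c₂, p₁} ∪ convexHull ℝ {c₁, c₂, p₂}

/-- An embedded circle pattern for `D` and the labelling `α`: a circle for every white
vertex and a point for every black vertex such that, for every face, the circles at its two white
vertices meet in the two distinct points at its black vertices, with exterior intersection angle
`α f`, which is the angle of the kite at either intersection point.
The pattern is embedded: distinct kites have disjoint interiors, and they
intersect exactly in the common vertex or in the common (straight) edge of the faces,
if there is one, and not at all otherwise. -/
structure EmbeddedCirclePattern {W B F : Type*} (D : BQuadGraph W B F) (α : F → ℝ) where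
  center : W → ℂ
  radius : W → ℝ
  point : B → ℂ
  radius_pos : ∀ w, 0 < radius w
  mem_circle : ∀ f, ∀ w ∈ D.whites f, ∀ b ∈ D.blacks f,
    point b ∈ Metric.sphere (center w) (radius w)
  point_ne : ∀ f, point (D.black₁ f) ≠ point (D.black₂ f)
  angle_eq : ∀ f, ∀ b ∈ D.blacks f,
    EuclideanGeometry.angle (center (D.white₁ f)) (point b) (center (D.white₂ f)) = α f
  disjoint_interior : ∀ f g, f ≠ g → Disjoint
    (interior (closedKite (center (D.white₁ f)) (center (D.white₂ f))
      (point (D.black₁ f)) (point (D.black₂ f))))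
    (interior (closedKite (center (D.white₁ g)) (center (D.white₂ g))
      (point (D.black₁ g)) (point (D.black₂ g))))
  inter_eq : ∀ f g, f ≠ g →
    closedKite (center (D.white₁ f)) (center (D.white₂ f))
        (point (D.black₁ f)) (point (D.black₂ f)) ∩
      closedKite (center (D.white₁ g)) (center (D.white₂ g))
        (point (D.black₁ g)) (point (D.black₂ g)) =
    convexHull ℝ (center '' (D.whites f ∩ D.whites g) ∪ point '' (D.blacks f ∩ D.blacks g))

/-- The function `f_θ(x) = (1/2i) log ((1 - e^(x-iθ)) / (1 - e^(x+iθ)))`, where the branch of the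
logarithm is chosen such that `0 < f_θ(x) < π`, for `0 < θ < π`. As numerator and denominator are
conjugate, this is minus the principal argument of the denominator; see `halfAngle_spec`. -/
def halfAngle (θ x : ℝ) : ℝ := -Complex.arg (1 - Complex.exp (x + θ * Complex.I))

/-- `halfAngle` is the branch of the logarithm with values in `(0, π)`. -/
theorem halfAngle_spec {θ : ℝ} (h0 : 0 < θ) (hpi : θ < Real.pi) (x : ℝ) :
    0 < halfAngle θ x ∧ halfAngle θ x < Real.pi ∧
      Complex.exp (2 * Complex.I * halfAngle θ x) =
        (1 - Complex.exp (x - θ * Complex.I)) / (1 - Complex.exp (x + θ * Complex.I)) := by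
  have him : (1 - Complex.exp (x + θ * Complex.I)).im < 0 := by
    have hs : 0 < Real.exp x * Real.sin θ :=
      mul_pos (Real.exp_pos x) (Real.sin_pos_of_pos_of_lt_pi h0 hpi)
    simpa [Complex.exp_im] using hs
  have hconj : 1 - Complex.exp (x - θ * Complex.I) =
      (starRingEnd ℂ) (1 - Complex.exp (x + θ * Complex.I)) := by
    rw [map_sub, map_one, ← Complex.exp_conj]
    simp [sub_eq_add_neg]
  rw [hconj]
  unfold halfAngle
  generalize 1 - Complex.exp (x + θ * Complex.I) = z at him
  have hz : z ≠ 0 := by rintro rfl; simp at him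
  refine ⟨?_, ?_, ?_⟩
  · linarith [Complex.arg_neg_iff.2 him]
  · linarith [Complex.neg_pi_lt_arg z]
  · have hn : (‖z‖ : ℂ) ≠ 0 := by simpa using hz
    have h1 := Complex.norm_mul_exp_arg_mul_I z
    have h2 : (starRingEnd ℂ) z = ‖z‖ * Complex.exp (-(Complex.arg z * Complex.I)) := by
      conv_lhs => rw [← h1]
      rw [map_mul, ← Complex.exp_conj]
      simp
    have h3 : (starRingEnd ℂ) z / z =
        ‖z‖ * Complex.exp (-(Complex.arg z * Complex.I)) /
          (‖z‖ * Complex.exp (Complex.arg z * Complex.I)) := by rw [h2, h1]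
    rw [h3, mul_div_mul_left _ _ hn, ← Complex.exp_sub]
    congr 1
    push_cast
    ring

namespace EmbeddedCirclePattern

variable {W B F : Type*} {D : BQuadGraph W B F} {α : F → ℝ} (P : EmbeddedCirclePattern D α)

/-- The closed kite of the pattern belonging to a face. -/
def kite (f : F) : Set ℂ :=
  closedKite (P.center (D.white₁ f)) (P.center (D.white₂ f))
    (P.point (D.black₁ f)) (P.point (D.black₂ f))

/-- The kites fill the whole plane. -/
def CoversPlane : Prop := ⋃ f, P.kite f = Set.univ

/-- Every compact set in the plane meets only finitely many kites. -/
def IsLocallyFinite : Prop :=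
  ∀ S : Set ℂ, IsCompact S → {f | (P.kite f ∩ S).Nonempty}.Finite

/-- The conductance `μ = 2 f'_α(log r(y) - log r(x))` of the edge of `G` between the white
vertices `x` and `y`, and `0` if there is no such edge. The edges of `G` between `x` and `y` are
the faces with the white vertices `x` and `y`, so the sum has at most one term. -/
def conductance (x y : W) : ℝ≥0∞ :=
  ∑' f : {f : F // D.Joins f x y},
    ENNReal.ofReal (2 * deriv (halfAngle (α f)) (Real.log (P.radius y) - Real.log (P.radius x)))

end EmbeddedCirclePattern

namespace Network

variable {V : Type*} (c : V → V → ℝ≥0∞)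

/-- Transition probabilities of the random walk on the network with conductances `c`. -/
def transition (x y : V) : ℝ≥0∞ := c x y / ∑' z, c x z

open Classical in
/-- The probability that the random walk started at `x` visits `o` at time `n + 1` and at none
of the times `1, …, n`. -/
def firstVisit (o : V) : ℕ → V → ℝ≥0∞
  | 0, x => transition c x o
  | n + 1, x => ∑' y, if y = o then 0 else transition c x y * firstVisit o n y

/-- The network is recurrent: from every starting vertex, the random walk returns to this
vertex with probability one. -/
def IsRecurrent : Prop := ∀ o : V, ∑' n, firstVisit c o n o = 1

end Network

end

open scoped ENNReal

open Topology MeasureTheory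

noncomputable section

/-! The conductance of a face is geometric. With `l` the distance of its two centres, the formula
for `f'_θ` and the law of cosines give `μ = 2 r₀ r₁ sin α / l²`, and `r₀ r₁ sin α` is the area of
the kite. Energies of functions of the centre are therefore controlled by areas in the plane, and
recurrence follows as for planar Brownian motion: cutoff functions have energy bounded independently
of the scale.

Let `φ` be 1 on centres in the disc of radius `R`, 0 outside radius `2R`, and linear in the norm
between. A face contributes at most `2 · area / max(l, R)²`. A long kite may leave the disc of
radius `4R`, so its area is compared with that of a shrunken open piece inside this disc
(`exists_isOpen_subset_kite`). Pieces of distinct kites are disjoint, so the total is at most a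
constant times `R² / R²` (`energy_cutoff_le`). This needs radii of order at most `R` near the disc,
supplied by `exists_radius_le`: the distance to the nearer intersection point of each kite glues to
a 1-Lipschitz function on the plane whose value at a centre is the radius.

Bounded energy suffices: averaging `n` nested cutoffs that vary on disjoint sets of edges divides
the bound by `n` (`exists_energy_le_div`), and a Picone inequality bounds conductance times escape
probability by the energy (`toReal_mul_one_sub_visitProb_le`). -/

namespace Network

/-! ### Random walks on networks: an energy criterion for recurrence. -/

variable {V : Type*}

/-- The probability that the random walk started at `x` visits `o` at some positive time. -/
def visitProb (c : V → V → ℝ≥0∞) (o x : V) : ℝ≥0∞ := ∑' n, firstVisit c o n x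

/-- Twice the Dirichlet energy of a function on the vertices of a network. -/
def energy (c : V → V → ℝ≥0∞) (φ : V → ℝ) : ℝ≥0∞ :=
  ∑' x, ∑' y, c x y * ENNReal.ofReal ((φ x - φ y) ^ 2)

variable {c : V → V → ℝ≥0∞}

theorem tsum_transition_le_one (x : V) : ∑' y, transition c x y ≤ 1 := by
  simp only [transition, div_eq_mul_inv]
  rw [ENNReal.tsum_mul_right]
  exact ENNReal.mul_inv_le_one _

open Classical in
theorem transition_eq_tsum_ite (o x : V) :
    transition c x o = ∑' y, if y = o then transition c x y else 0 := by
  rw [tsum_ite_eq]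

-- First-step analysis at a finite time horizon; it drives the induction for `visitProb_le_one`.
open Classical in
theorem sum_firstVisit_succ (o x : V) (N : ℕ) :
    ∑ n ∈ Finset.range (N + 1), firstVisit c o n x =
      ∑' y, transition c x y * if y = o then 1 else ∑ n ∈ Finset.range N, firstVisit c o n y := by
  rw [Finset.sum_range_succ']
  simp only [firstVisit]
  rw [← Summable.tsum_finsetSum (fun _ _ => ENNReal.summable), transition_eq_tsum_ite,
    ← ENNReal.tsum_add]
  refine tsum_congr fun y => ?_
  split_ifs <;> simp [Finset.mul_sum]

open Classical in
theorem visitProb_eq (o x : V) :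
    visitProb c o x = ∑' y, transition c x y * if y = o then 1 else visitProb c o y := by
  unfold visitProb
  rw [tsum_eq_zero_add' ENNReal.summable]
  simp only [firstVisit]
  rw [ENNReal.tsum_comm, transition_eq_tsum_ite, ← ENNReal.tsum_add]
  refine tsum_congr fun y => ?_
  split_ifs <;> simp [ENNReal.tsum_mul_left]

theorem visitProb_le_one (o x : V) : visitProb c o x ≤ 1 := by
  classical
  refine ENNReal.tsum_le_of_sum_range_le fun N => ?_
  induction N generalizing x with
  | zero => simp
  | succ N ih =>
    rw [sum_firstVisit_succ]
    refine le_trans (ENNReal.tsum_le_tsum fun y => ?_) (tsum_transition_le_one (c := c) x)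
    refine mul_le_of_le_one_right' ?_
    split_ifs
    exacts [le_rfl, ih y]

/-- The difference of the two sides is a square divided by `s * t`. This is the Picone inequality on
a single edge. -/
theorem sq_div_sub_mul_sub_le {a b s t : ℝ} (hs : 0 < s) (ht : 0 < t) :
    (a ^ 2 / s - b ^ 2 / t) * (s - t) ≤ (a - b) ^ 2 := by
  have h : (a - b) ^ 2 - (a ^ 2 / s - b ^ 2 / t) * (s - t) = (a * t - b * s) ^ 2 / (s * t) := by
    field_simp
    ring
  have : 0 ≤ (a * t - b * s) ^ 2 / (s * t) := by positivity
  linarith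

/-- The discrete Picone inequality: a positive function `u` has `∑ φ² / u * Δ u ≤ E(φ)`. -/
theorem two_mul_sum_div_mul_laplacian_le {k : V → V → ℝ} (T : Finset V) (hk : ∀ x y, 0 ≤ k x y)
    (hsymm : ∀ x y, k x y = k y x) {u : V → ℝ} (hu : ∀ x, 0 < u x) (φ : V → ℝ) :
    2 * ∑ x ∈ T, φ x ^ 2 / u x * ∑ y ∈ T, k x y * (u x - u y) ≤
      ∑ x ∈ T, ∑ y ∈ T, k x y * (φ x - φ y) ^ 2 := by
  have h1 : ∑ x ∈ T, φ x ^ 2 / u x * ∑ y ∈ T, k x y * (u x - u y) =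
      ∑ x ∈ T, ∑ y ∈ T, k x y * (φ x ^ 2 / u x * (u x - u y)) := by
    refine Finset.sum_congr rfl fun x _ => ?_
    rw [Finset.mul_sum]
    exact Finset.sum_congr rfl fun y _ => by ring
  -- Summation by parts: exchanging `x` and `y` gives a second form of the sum, and adding both
  -- forms leaves the edgewise expression bounded above.
  have h2 : ∑ x ∈ T, φ x ^ 2 / u x * ∑ y ∈ T, k x y * (u x - u y) =
      ∑ x ∈ T, ∑ y ∈ T, k x y * (-(φ y ^ 2 / u y) * (u x - u y)) := by
    rw [h1, Finset.sum_comm]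
    refine Finset.sum_congr rfl fun x _ => Finset.sum_congr rfl fun y _ => ?_
    rw [hsymm y x]
    ring
  rw [two_mul]
  nth_rewrite 1 [h1]
  rw [h2, ← Finset.sum_add_distrib]
  refine Finset.sum_le_sum fun x _ => ?_
  rw [← Finset.sum_add_distrib]
  refine Finset.sum_le_sum fun y _ => ?_
  rw [← mul_add]
  refine mul_le_mul_of_nonneg_left ?_ (hk x y)
  linarith [sq_div_sub_mul_sub_le (a := φ x) (b := φ y) (hu x) (hu y)]

theorem tsum_conductance_ne_top (hfin : ∀ x y, c x y ≠ ∞) (hloc : ∀ x, {y | c x y ≠ 0}.Finite)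
    (x : V) : ∑' y, c x y ≠ ∞ := by
  rw [tsum_eq_sum (s := (hloc x).toFinset) (by simp)]
  exact ENNReal.sum_ne_top.2 fun y _ => hfin x y

-- Harmonicity of the visit probability in real numbers, with the value at `o` on the right replaced
-- by 1. The finite set `T` has to contain all neighbours of `x`.
open Classical in
theorem toReal_mul_visitProb (hfin : ∀ x y, c x y ≠ ∞) (hloc : ∀ x, {y | c x y ≠ 0}.Finite)
    (hne : ∀ x, ∃ y, c x y ≠ 0) (o x : V) (T : Finset V) (hT : (hloc x).toFinset ⊆ T) :
    (∑ y ∈ T, (c x y).toReal) * (visitProb c o x).toReal =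
      ∑ y ∈ T, (c x y).toReal * (if y = o then 1 else (visitProb c o y).toReal) := by
  have h0 : ∀ y ∉ T, c x y = 0 := fun y hy => by
    by_contra h
    exact hy (hT (by simpa using h))
  have hsum : ∑' y, c x y = ∑ y ∈ T, c x y := tsum_eq_sum h0
  have hpos : ∑' y, c x y ≠ 0 := by
    obtain ⟨y, hy⟩ := hne x
    exact fun h => hy (ENNReal.tsum_eq_zero.1 h y)
  have htop := tsum_conductance_ne_top hfin hloc x
  have key : (∑' y, c x y) * visitProb c o x =
      ∑ y ∈ T, c x y * (if y = o then 1 else visitProb c o y) := by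
    have hT' : ∑' y, c x y * (if y = o then 1 else visitProb c o y) =
        ∑ y ∈ T, c x y * (if y = o then 1 else visitProb c o y) :=
      tsum_eq_sum fun y hy => by simp [h0 y hy]
    rw [visitProb_eq, ← ENNReal.tsum_mul_left, ← hT']
    refine tsum_congr fun y => ?_
    rw [← mul_assoc, transition, ENNReal.mul_div_cancel hpos htop]
  have h := congrArg ENNReal.toReal key
  rw [ENNReal.toReal_mul, hsum, ENNReal.toReal_sum fun y _ => hfin x y,
    ENNReal.toReal_sum] at h
  · rw [h]
    refine Finset.sum_congr rfl fun y _ => ?_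
    split_ifs <;> simp
  · intro y _
    refine ENNReal.mul_ne_top (hfin x y) ?_
    split_ifs
    · simp
    · exact ne_top_of_le_ne_top ENNReal.one_ne_top (visitProb_le_one o y)

theorem sum_toReal_mul_sub_sq_le {φ : V → ℝ} {ε : ℝ} (hε : 0 ≤ ε) (hfin : ∀ x y, c x y ≠ ∞)
    (h : energy c φ ≤ ENNReal.ofReal ε) (T : Finset V) :
    ∑ x ∈ T, ∑ y ∈ T, (c x y).toReal * (φ x - φ y) ^ 2 ≤ ε := by
  rw [← ENNReal.ofReal_le_ofReal_iff hε]
  refine le_trans ?_ h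
  rw [ENNReal.ofReal_sum_of_nonneg fun x _ => Finset.sum_nonneg fun y _ => by positivity]
  refine le_trans (Finset.sum_le_sum fun x _ => ?_) (ENNReal.sum_le_tsum T)
  rw [ENNReal.ofReal_sum_of_nonneg fun y _ => by positivity]
  refine le_trans (Finset.sum_le_sum fun y _ => ?_) (ENNReal.sum_le_tsum T)
  rw [ENNReal.ofReal_mul ENNReal.toReal_nonneg, ENNReal.ofReal_toReal (hfin x y)]

/-- The conductance times the escape probability at `o` is at most the energy of every finitely
supported function with the value `1` at `o`. -/
theorem toReal_mul_one_sub_visitProb_le (hsymm : ∀ x y, c x y = c y x) (hfin : ∀ x y, c x y ≠ ∞)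
    (hloc : ∀ x, {y | c x y ≠ 0}.Finite) (hne : ∀ x, ∃ y, c x y ≠ 0) {o : V} {φ : V → ℝ}
    (hφ : φ.support.Finite) (hφo : φ o = 1) {ε : ℝ} (hε : 0 ≤ ε)
    (h : energy c φ ≤ ENNReal.ofReal ε) :
    (∑' y, c o y).toReal * (1 - (visitProb c o o).toReal) ≤ ε := by
  classical
  -- The neighbours are included so that sums over `T` give the full Laplacian at each point of the
  -- support.
  let T : Finset V := hφ.toFinset ∪ hφ.toFinset.biUnion fun x => (hloc x).toFinset
  have hTS : ∀ x, φ x ≠ 0 → x ∈ T := fun x hx => by simp [T, hx]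
  have hTN : ∀ x, φ x ≠ 0 → (hloc x).toFinset ⊆ T := fun x hx y hy =>
    Finset.mem_union_right _ (Finset.mem_biUnion.2 ⟨x, by simpa using hx, hy⟩)
  have hφo' : φ o ≠ 0 := by simp [hφo]
  -- `H` is harmonic away from `o`, and its Laplacian at `o` is the conductance times the escape
  -- probability.
  let H : V → ℝ := fun y => if y = o then 1 else (visitProb c o y).toReal
  have hH : ∀ x, 0 ≤ H x := fun x => by
    simp only [H]
    split_ifs <;> simp
  -- Adding 1 makes `H` strictly positive without changing its Laplacian; the value 2 at `o` then
  -- cancels the factor 2.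
  have hpic := two_mul_sum_div_mul_laplacian_le (k := fun x y => (c x y).toReal) T
    (fun _ _ => ENNReal.toReal_nonneg) (fun x y => by rw [hsymm x y]) (u := fun x => H x + 1)
    (fun x => by linarith [hH x]) φ
  refine le_trans (le_of_eq ?_) (hpic.trans (sum_toReal_mul_sub_sq_le hε hfin h T))
  have hlap : ∀ x, φ x ≠ 0 → ∑ y ∈ T, (c x y).toReal * (H x + 1 - (H y + 1)) =
      (∑ y ∈ T, (c x y).toReal) * (H x - (visitProb c o x).toReal) := fun x hx => by
    rw [mul_sub, toReal_mul_visitProb hfin hloc hne o x T (hTN x hx), Finset.sum_mul,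
      ← Finset.sum_sub_distrib]
    refine Finset.sum_congr rfl fun y _ => ?_
    simp only [H]
    ring
  rw [Finset.sum_eq_single_of_mem o (hTS o hφo'), hlap o hφo']
  · have hsum : ∑' y, c o y = ∑ y ∈ T, c o y := tsum_eq_sum fun y hy => by
      by_contra hne'
      exact hy (hTN o hφo' (by simpa using hne'))
    rw [hsum, ENNReal.toReal_sum fun y _ => hfin o y]
    simp only [H, hφo, if_true]
    ring
  · intro x _ hxo
    by_cases hx : φ x = 0
    · simp [hx]
    · rw [hlap x hx]
      simp [H, hxo]

theorem isRecurrent_of_energy_le (hsymm : ∀ x y, c x y = c y x) (hfin : ∀ x y, c x y ≠ ∞)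
    (hloc : ∀ x, {y | c x y ≠ 0}.Finite) (hne : ∀ x, ∃ y, c x y ≠ 0)
    (h : ∀ o : V, ∀ ε : ℝ, 0 < ε → ∃ φ : V → ℝ, φ.support.Finite ∧ φ o = 1 ∧
      energy c φ ≤ ENNReal.ofReal ε) : IsRecurrent c := by
  intro o
  change visitProb c o o = 1
  have hle := visitProb_le_one (c := c) o o
  have hpos : 0 < (∑' y, c o y).toReal := by
    refine ENNReal.toReal_pos ?_ (tsum_conductance_ne_top hfin hloc o)
    obtain ⟨y, hy⟩ := hne o
    exact fun h => hy (ENNReal.tsum_eq_zero.1 h y)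
  have hmul : (∑' y, c o y).toReal * (1 - (visitProb c o o).toReal) ≤ 0 := by
    refine le_of_forall_pos_le_add fun ε hε => ?_
    obtain ⟨φ, hφ, hφo, hE⟩ := h o ε hε
    rw [zero_add]
    exact toReal_mul_one_sub_visitProb_le hsymm hfin hloc hne hφ hφo hε.le hE
  refine le_antisymm hle ?_
  rw [← ENNReal.ofReal_toReal (ne_top_of_le_ne_top ENNReal.one_ne_top hle), ← ENNReal.ofReal_one]
  exact ENNReal.ofReal_le_ofReal (by nlinarith)

/-- If finite sets have finitely supported cutoff functions of uniformly bounded energy, then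
averages of nested cutoff functions have arbitrarily small energy. -/
theorem exists_energy_le_div (hsymm : ∀ x y, c x y = c y x)
    (hloc : ∀ x, {y | c x y ≠ 0}.Finite) {C : ℝ} (hC : 0 ≤ C)
    (h : ∀ S : Set V, S.Finite → ∃ φ : V → ℝ, φ.support.Finite ∧ (∀ x ∈ S, φ x = 1) ∧
      energy c φ ≤ ENNReal.ofReal C) (n : ℕ) :
    ∀ S : Set V, S.Finite → ∃ φ : V → ℝ, φ.support.Finite ∧ (∀ x ∈ S, φ x = 1) ∧
      energy c φ ≤ ENNReal.ofReal (C / (n + 1)) := by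
  induction n with
  | zero => simpa using h
  | succ n ih =>
    intro S hS
    obtain ⟨φ, hφ, hφS, hφE⟩ := ih S hS
    -- `χ` is constant on every edge meeting the support of `φ`, so the cross terms vanish and the
    -- energies of the weighted average add up: `((n+1)² · C/(n+1) + C) / (n+2)² = C/(n+2)`.
    obtain ⟨χ, hχ, hχS, hχE⟩ := h (S ∪ φ.support ∪ ⋃ x ∈ φ.support, {y | c x y ≠ 0})
      ((hS.union hφ).union (hφ.biUnion fun x _ => hloc x))
    have hn : (0 : ℝ) < n + 1 := by positivity
    have hn' : (0 : ℝ) < n + 2 := by positivity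
    refine ⟨fun x => ((n + 1) * φ x + χ x) / (n + 2), ?_, ?_, ?_⟩
    · refine (hφ.union hχ).subset fun x hx => ?_
      by_contra hx'
      simp only [Set.mem_union, Function.mem_support, not_or, not_not] at hx'
      exact hx (by simp [hx'.1, hx'.2])
    · intro x hx
      simp only [hφS x hx, hχS x (Or.inl (Or.inl hx))]
      field_simp
      ring
    · have hnear : ∀ x y, c x y ≠ 0 → φ x ≠ 0 → χ x = 1 ∧ χ y = 1 := fun x y hxy hx =>
        ⟨hχS x (Or.inl (Or.inr hx)), hχS y (Or.inr (Set.mem_biUnion hx hxy))⟩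
      have hterm : ∀ x y, c x y * ENNReal.ofReal
          ((((n + 1) * φ x + χ x) / (n + 2) - ((n + 1) * φ y + χ y) / (n + 2)) ^ 2) =
          ENNReal.ofReal ((n + 1) ^ 2 / (n + 2) ^ 2) * (c x y * ENNReal.ofReal ((φ x - φ y) ^ 2)) +
          ENNReal.ofReal (1 / (n + 2) ^ 2) * (c x y * ENNReal.ofReal ((χ x - χ y) ^ 2)) := by
        intro x y
        by_cases hxy : c x y = 0
        · simp [hxy]
        have hzero : (φ x - φ y) * (χ x - χ y) = 0 := by
          by_cases hx : φ x = 0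
          · by_cases hy : φ y = 0
            · simp [hx, hy]
            · obtain ⟨h1, h2⟩ := hnear y x (by rwa [hsymm]) hy
              simp [h1, h2]
          · obtain ⟨h1, h2⟩ := hnear x y hxy hx
            simp [h1, h2]
        have hsq : (((n + 1) * φ x + χ x) / (n + 2) - ((n + 1) * φ y + χ y) / (n + 2)) ^ 2 =
            (n + 1) ^ 2 / (n + 2) ^ 2 * (φ x - φ y) ^ 2 +
              1 / (n + 2) ^ 2 * (χ x - χ y) ^ 2 := by
          field_simp
          linear_combination 2 * ((n : ℝ) + 1) * hzero
        rw [hsq, ENNReal.ofReal_add (by positivity) (by positivity),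
          ENNReal.ofReal_mul (by positivity), ENNReal.ofReal_mul (by positivity)]
        ring
      have hE : energy c (fun x => ((n + 1) * φ x + χ x) / (n + 2)) =
          ENNReal.ofReal ((n + 1) ^ 2 / (n + 2) ^ 2) * energy c φ +
          ENNReal.ofReal (1 / (n + 2) ^ 2) * energy c χ := by
        simp only [energy, hterm, ENNReal.tsum_add, ENNReal.tsum_mul_left]
      rw [hE]
      refine (add_le_add (mul_le_mul_right hφE _) (mul_le_mul_right hχE _)).trans ?_
      rw [← ENNReal.ofReal_mul (by positivity), ← ENNReal.ofReal_mul (by positivity),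
        ← ENNReal.ofReal_add (by positivity) (by positivity)]
      refine ENNReal.ofReal_le_ofReal (le_of_eq ?_)
      push_cast
      field_simp
      ring

theorem isRecurrent_of_forall_finite_exists_energy_le (hsymm : ∀ x y, c x y = c y x)
    (hfin : ∀ x y, c x y ≠ ∞) (hloc : ∀ x, {y | c x y ≠ 0}.Finite) (hne : ∀ x, ∃ y, c x y ≠ 0)
    {C : ℝ} (hC : 0 ≤ C)
    (h : ∀ S : Set V, S.Finite → ∃ φ : V → ℝ, φ.support.Finite ∧ (∀ x ∈ S, φ x = 1) ∧
      energy c φ ≤ ENNReal.ofReal C) : IsRecurrent c := by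
  refine isRecurrent_of_energy_le hsymm hfin hloc hne fun o ε hε => ?_
  obtain ⟨n, hn⟩ := exists_nat_gt (C / ε)
  obtain ⟨φ, hφ, hφo, hE⟩ :=
    exists_energy_le_div hsymm hloc hC h n {o} (Set.finite_singleton o)
  refine ⟨φ, hφ, hφo o rfl, hE.trans (ENNReal.ofReal_le_ofReal ?_)⟩
  rw [div_lt_iff₀ hε] at hn
  rw [div_le_iff₀ (by positivity)]
  nlinarith

end Network

/-! ### The derivative of `halfAngle`, and areas in the plane. -/

theorem hasDerivAt_halfAngle {θ : ℝ} (h0 : 0 < θ) (hpi : θ < Real.pi) (x : ℝ) :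
    HasDerivAt (halfAngle θ) (Real.exp x * Real.sin θ /
      (1 - 2 * Real.exp x * Real.cos θ + Real.exp x ^ 2)) x := by
  have hs : 0 < Real.exp x * Real.sin θ :=
    mul_pos (Real.exp_pos x) (Real.sin_pos_of_pos_of_lt_pi h0 hpi)
  have him : (1 - Complex.exp (x + θ * Complex.I)).im = -(Real.exp x * Real.sin θ) := by
    simp [Complex.exp_im]
  have hre : (1 - Complex.exp (x + θ * Complex.I)).re = 1 - Real.exp x * Real.cos θ := by
    simp [Complex.exp_re]
  have h1 : HasDerivAt (fun t : ℝ => 1 - Complex.exp (t + θ * Complex.I))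
      (-Complex.exp (x + θ * Complex.I)) x := by
    simpa using
      (((Complex.ofRealCLM.hasDerivAt (x := x)).add_const (θ * Complex.I)).cexp).const_sub 1
  have h2 := (h1.clog_real (Or.inr (by rw [him]; linarith)))
  have h3 := (Complex.imCLM.hasFDerivAt.comp_hasDerivAt x h2).neg
  refine (h3.congr_deriv ?_).congr_of_eventuallyEq (Filter.Eventually.of_forall fun t => ?_)
  · simp only [Complex.imCLM_apply, Complex.div_im, him, hre, Complex.normSq_apply,
      Complex.neg_im, Complex.neg_re, Complex.exp_re, Complex.exp_im]
    have hd : (1 - Real.exp x * Real.cos θ) * (1 - Real.exp x * Real.cos θ) +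
        -(Real.exp x * Real.sin θ) * -(Real.exp x * Real.sin θ) =
        1 - 2 * Real.exp x * Real.cos θ + Real.exp x ^ 2 := by
      linear_combination Real.exp x ^ 2 * Real.sin_sq_add_cos_sq θ
    rw [hd]
    simp
    ring
  · simp [halfAngle, Complex.log_im]

/-- The determinant of two vectors of the plane. -/
def crossProd (a b : ℂ) : ℝ := a.re * b.im - a.im * b.re

/-- Both sides are twice the area of the triangle. The squares agree by Lagrange's identity for
inner product and determinant. -/
theorem abs_crossProd_sub_sub (c₀ c₁ p : ℂ) :
    |crossProd (c₁ - c₀) (p - c₀)| =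
      dist p c₀ * dist p c₁ * Real.sin (EuclideanGeometry.angle c₀ p c₁) := by
  have h := InnerProductGeometry.cos_angle_mul_norm_mul_norm (c₀ - p) (c₁ - p)
  have hn0 := Complex.sq_norm (c₀ - p)
  have hn1 := Complex.sq_norm (c₁ - p)
  rw [Complex.inner] at h
  rw [EuclideanGeometry.angle, vsub_eq_sub, vsub_eq_sub, dist_comm p, dist_comm p,
    Complex.dist_eq, Complex.dist_eq]
  set a := InnerProductGeometry.angle (c₀ - p) (c₁ - p) with ha
  have hsin : 0 ≤ Real.sin a := Real.sin_nonneg_of_nonneg_of_le_pi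
    (InnerProductGeometry.angle_nonneg _ _) (InnerProductGeometry.angle_le_pi _ _)
  rw [← abs_of_nonneg (show 0 ≤ ‖c₀ - p‖ * ‖c₁ - p‖ * Real.sin a by positivity),
    ← sq_eq_sq_iff_abs_eq_abs]
  have hsc := Real.sin_sq_add_cos_sq a
  rw [Complex.normSq_apply] at hn0 hn1
  simp only [crossProd, Complex.sub_re, Complex.sub_im, Complex.mul_re, Complex.conj_re,
    Complex.conj_im, map_sub] at h hn0 hn1 ⊢
  have h2 := congrArg (· ^ 2) h
  have : (‖c₀ - p‖ * ‖c₁ - p‖ * Real.sin a) ^ 2 = ‖c₀ - p‖ ^ 2 * ‖c₁ - p‖ ^ 2 -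
      (Real.cos a * (‖c₀ - p‖ * ‖c₁ - p‖)) ^ 2 := by
    linear_combination (‖c₀ - p‖ * ‖c₁ - p‖) ^ 2 * hsc
  rw [this, h2, hn0, hn1]
  ring

/-- The open parallelogram at `o` with the sides `a` and `b`. -/
def openParallelogram (o a b : ℂ) : Set ℂ :=
  (fun z : ℂ => o + (z.re • a + z.im • b)) '' (Set.Ioo 0 1 ×ℂ Set.Ioo 0 1)

/-- The linear map of the plane that sends `1` to `a` and `I` to `b`. -/
def frameMap (a b : ℂ) : ℂ →ₗ[ℝ] ℂ :=
  Complex.reLm.smulRight a + Complex.imLm.smulRight b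

theorem det_frameMap (a b : ℂ) : LinearMap.det (frameMap a b) = crossProd a b := by
  rw [← LinearMap.det_toMatrix Complex.basisOneI, Matrix.det_fin_two]
  simp [LinearMap.toMatrix_apply, frameMap, crossProd]
  ring

theorem openParallelogram_eq (o a b : ℂ) :
    openParallelogram o a b = (o + ·) '' (frameMap a b '' (Set.Ioo 0 1 ×ℂ Set.Ioo 0 1)) := by
  rw [Set.image_image]
  rfl

theorem isOpen_openParallelogram (o : ℂ) {a b : ℂ} (h : crossProd a b ≠ 0) :
    IsOpen (openParallelogram o a b) := by
  rw [openParallelogram_eq]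
  refine (isOpenMap_add_left o) _ ((frameMap a b).isOpenMap_of_finiteDimensional ?_ _
    (isOpen_Ioo.reProdIm isOpen_Ioo))
  rw [← det_frameMap] at h
  exact (LinearMap.equivOfDetNeZero _ h).surjective

theorem volume_openParallelogram (o a b : ℂ) :
    volume (openParallelogram o a b) = ENNReal.ofReal |crossProd a b| := by
  have h1 : volume (Set.Ioo (0 : ℝ) 1 ×ℂ Set.Ioo 0 1) = 1 := by
    have := Complex.volume_preserving_equiv_real_prod.measure_preimage
      (s := Set.Ioo (0 : ℝ) 1 ×ˢ Set.Ioo (0 : ℝ) 1)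
      (measurableSet_Ioo.prod measurableSet_Ioo).nullMeasurableSet
    rw [Measure.volume_eq_prod, Measure.prod_prod] at this
    refine Eq.trans (congrArg volume ?_) (this.trans (by simp))
    ext z
    simp [Complex.mem_reProdIm]
  rw [openParallelogram_eq, Set.image_add_left, measure_preimage_add,
    Measure.addHaar_image_linearMap, det_frameMap, h1, mul_one]

/-- A triangle with a vertex near the origin contains an open set near the origin whose area is,
up to a constant, that of the triangle scaled down to the size `R`. -/
theorem exists_isOpen_subset_triangle {c₀ c₁ p : ℂ} {R : ℝ} (hR : 0 < R) (hc : ‖c₀‖ < 2 * R)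
    (hp : dist p c₀ ≤ 3 * R) :
    ∃ A : Set ℂ, IsOpen A ∧ A ⊆ convexHull ℝ {c₀, c₁, p} ∧ A ⊆ Metric.ball 0 (4 * R) ∧
      volume A = ENNReal.ofReal
        (R ^ 2 / (4 * max (dist c₀ c₁) R ^ 2) * |crossProd (c₁ - c₀) (p - c₀)|) := by
  by_cases hdet : crossProd (c₁ - c₀) (p - c₀) = 0
  · exact ⟨∅, isOpen_empty, Set.empty_subset _, Set.empty_subset _, by simp [hdet]⟩
  set m := max (dist c₀ c₁) R with hm
  have hRm : R ≤ m := le_max_right _ _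
  have hlm : dist c₀ c₁ ≤ m := le_max_left _ _
  have hm0 : 0 < m := hR.trans_le hRm
  -- `k ≤ 1/2` keeps the parallelogram inside the triangle. Its sides are at most `k * m = R/2` and
  -- `k * 3R ≤ 3R/2`, so starting within `2R` of the origin it stays within `4R`.
  set k := R / (2 * m) with hk
  have hk0 : 0 < k := by positivity
  have hk1 : k ≤ 1 / 2 := by rw [hk, div_le_iff₀ (by positivity)]; linarith
  have hcross : crossProd (k • (c₁ - c₀)) (k • (p - c₀)) =
      k ^ 2 * crossProd (c₁ - c₀) (p - c₀) := by
    simp [crossProd]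
    ring
  refine ⟨openParallelogram c₀ (k • (c₁ - c₀)) (k • (p - c₀)),
    isOpen_openParallelogram _ (by rw [hcross]; positivity), ?_, ?_, ?_⟩
  · rintro _ ⟨z, hz, rfl⟩
    rw [Complex.mem_reProdIm] at hz
    obtain ⟨⟨hs0, hs1⟩, ht0, ht1⟩ := hz
    rw [convexHull_insert (by simp), convexHull_pair, mem_convexJoin]
    have hsum : 0 < z.re + z.im := by linarith
    refine ⟨c₀, rfl, c₁ + (z.im / (z.re + z.im)) • (p - c₁), ?_, ?_⟩
    · rw [segment_eq_image']
      exact ⟨_, ⟨by positivity, by rw [div_le_one hsum]; linarith⟩, rfl⟩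
    · rw [segment_eq_image']
      refine ⟨k * (z.re + z.im), ⟨by positivity, by nlinarith⟩, ?_⟩
      have h1 : ((z.re + z.im : ℝ) : ℂ) ≠ 0 := by exact_mod_cast hsum.ne'
      simp only [Complex.real_smul]
      push_cast at h1 ⊢
      field_simp
      ring
  · rintro _ ⟨z, hz, rfl⟩
    rw [Complex.mem_reProdIm] at hz
    obtain ⟨⟨hs0, hs1⟩, ht0, ht1⟩ := hz
    rw [mem_ball_zero_iff]
    have h1 : ‖z.re • k • (c₁ - c₀)‖ ≤ k * m := by
      rw [norm_smul, norm_smul, Real.norm_of_nonneg hs0.le, Real.norm_of_nonneg hk0.le,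
        ← dist_eq_norm, dist_comm]
      have : k * dist c₀ c₁ ≤ k * m := by gcongr
      have : 0 ≤ k * dist c₀ c₁ := by positivity
      nlinarith
    have h2 : ‖z.im • k • (p - c₀)‖ ≤ k * (3 * R) := by
      rw [norm_smul, norm_smul, Real.norm_of_nonneg ht0.le, Real.norm_of_nonneg hk0.le,
        ← dist_eq_norm]
      have : k * dist p c₀ ≤ k * (3 * R) := by gcongr
      have : 0 ≤ k * dist p c₀ := by positivity
      nlinarith
    have hkm : k * m = R / 2 := by rw [hk]; field_simp
    have h3 := norm_add_le c₀ (z.re • k • (c₁ - c₀) + z.im • k • (p - c₀))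
    have h4 := norm_add_le (z.re • k • (c₁ - c₀)) (z.im • k • (p - c₀))
    nlinarith
  · rw [volume_openParallelogram, hcross, abs_mul, abs_of_nonneg (sq_nonneg k), hk]
    congr 2
    field_simp
    ring

/-! ### Gluing Lipschitz functions. -/

/-- A function that is `1`-Lipschitz on each set of a locally finite closed cover of a normed space
is `1`-Lipschitz. -/
theorem LipschitzWith.of_locallyFinite_cover {E ι : Type*} [NormedAddCommGroup E] [NormedSpace ℝ E]
    {K : ι → Set E} (hK : LocallyFinite K) (hcl : ∀ i, IsClosed (K i)) (hcov : ⋃ i, K i = Set.univ)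
    {g : E → ℝ} (hg : ∀ i, LipschitzOnWith 1 g (K i)) : LipschitzWith 1 g := by
  have hcont : Continuous g := hK.continuous hcov hcl fun i => (hg i).continuousOn
  -- By local finiteness and closedness, any piece containing a point close enough to `z` also
  -- contains `z`.
  have hloc : ∀ z, ∀ᶠ w in 𝓝 z, dist (g w) (g z) ≤ dist w z := fun z => by
    filter_upwards [hK.eventually_subset hcl z] with w hw
    obtain ⟨i, hi⟩ := Set.mem_iUnion.1 (hcov ▸ Set.mem_univ w : w ∈ ⋃ i, K i)
    simpa using (hg i).dist_le_mul w hi z (hw hi)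
  refine LipschitzWith.of_dist_le_mul fun z w => ?_
  let γ : ℝ → E := fun t => AffineMap.lineMap z w t
  have hγ : Continuous γ := AffineMap.lineMap_continuous
  let S : Set ℝ := {t | dist (g (γ t)) (g z) ≤ t * dist z w}
  have hS : IsClosed S := isClosed_le ((hcont.comp hγ).dist continuous_const)
    (continuous_id.mul continuous_const)
  -- Continuous induction along the segment: `S` is closed, contains 0, and `hloc` extends it to the
  -- right of each of its points.
  have h1 : (1 : ℝ) ∈ S := by
    refine (hS.inter isClosed_Icc).Icc_subset_of_forall_mem_nhdsWithin (a := 0) (b := 1) ?_ ?_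
      ⟨zero_le_one, le_rfl⟩
    · simp [S, γ]
    · rintro t ⟨ht, -⟩
      have h2 := (hγ.tendsto t).eventually (hloc (γ t))
      filter_upwards [mem_nhdsWithin_of_mem_nhds h2, self_mem_nhdsWithin] with s hs hts
      have h3 : dist (γ s) (γ t) = (s - t) * dist z w := by
        simp only [γ]
        rw [dist_lineMap_lineMap, Real.dist_eq, abs_of_pos (sub_pos.2 hts)]
      have h4 := dist_triangle (g (γ s)) (g (γ t)) (g z)
      simp only [S, Set.mem_ofPred_eq] at ht ⊢
      have h5 : dist (g (γ s)) (g (γ t)) ≤ dist (γ s) (γ t) := hs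
      rw [h3] at h5
      linarith
  have : dist (g w) (g z) ≤ 1 * dist z w := by simpa [S, γ] using h1
  rw [dist_comm (g z)]
  simpa using this

theorem isClosed_closedKite (c₁ c₂ p₁ p₂ : ℂ) : IsClosed (closedKite c₁ c₂ p₁ p₂) :=
  ((Set.toFinite _).isCompact_convexHull ℝ).isClosed.union
    ((Set.toFinite _).isCompact_convexHull ℝ).isClosed

/-! ### Linear growth of the radii. -/

namespace EmbeddedCirclePattern

variable {W B F : Type*} {D : BQuadGraph W B F} {α : F → ℝ} (P : EmbeddedCirclePattern D α)

theorem isClosed_kite (f : F) : IsClosed (P.kite f) := isClosed_closedKite _ _ _ _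

theorem center_mem_kite {f : F} {w : W} (hw : w ∈ D.whites f) : P.center w ∈ P.kite f := by
  refine Or.inl (subset_convexHull ℝ _ ?_)
  rcases hw with rfl | rfl <;> simp

theorem exists_mem_whites (w : W) : ∃ f, w ∈ D.whites f := D.white_incident w

theorem dist_point_center {f : F} {w : W} {b : B} (hw : w ∈ D.whites f) (hb : b ∈ D.blacks f) :
    dist (P.point b) (P.center w) = P.radius w := P.mem_circle f w hw b hb

theorem black₁_mem (f : F) : D.black₁ f ∈ D.blacks f := Or.inl rfl

theorem white₁_mem (f : F) : D.white₁ f ∈ D.whites f := Or.inl rfl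

theorem white₂_mem (f : F) : D.white₂ f ∈ D.whites f := Or.inr rfl

/-- The distance to the nearest of the two intersection points of a face. -/
def faceDist (f : F) (z : ℂ) : ℝ :=
  min (dist z (P.point (D.black₁ f))) (dist z (P.point (D.black₂ f)))

theorem lipschitzWith_faceDist (f : F) : LipschitzWith 1 (P.faceDist f) := by
  have h : ∀ p : ℂ, LipschitzWith 1 fun z : ℂ => dist z p := fun p => LipschitzWith.dist_left p
  have h' := (h (P.point (D.black₁ f))).min (h (P.point (D.black₂ f)))
  rwa [max_self] at h'

theorem faceDist_eq_of_le {f : F} {b : B} {z : ℂ} (hb : b ∈ D.blacks f)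
    (h : ∀ b' ∈ D.blacks f, dist z (P.point b) ≤ dist z (P.point b')) :
    P.faceDist f z = dist z (P.point b) := by
  rcases hb with rfl | rfl
  · exact min_eq_left (h _ (Or.inr rfl))
  · exact min_eq_right (h _ (Or.inl rfl))

theorem faceDist_center {f : F} {w : W} (hw : w ∈ D.whites f) :
    P.faceDist f (P.center w) = P.radius w := by
  unfold faceDist
  rw [dist_comm, dist_comm _ (P.point (D.black₂ f)), P.dist_point_center hw (Or.inl rfl),
    P.dist_point_center hw (Or.inr rfl), min_self]

/-- Both intersection points are at distance `radius w` from the centre, so by the triangle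
inequality a point on the radius towards `b` has `b` as a nearest one. Hence on an edge of the kite
the function depends on that edge alone. -/
theorem faceDist_of_mem_segment {f : F} {w : W} {b : B} {z : ℂ} (hw : w ∈ D.whites f)
    (hb : b ∈ D.blacks f) (hz : z ∈ segment ℝ (P.center w) (P.point b)) :
    P.faceDist f z = dist z (P.point b) := by
  refine P.faceDist_eq_of_le hb fun b' hb' => ?_
  have h1 := dist_add_dist_of_mem_segment hz
  have h2 := dist_triangle (P.center w) z (P.point b')
  rw [dist_comm (P.center w) (P.point b), P.dist_point_center hw hb] at h1
  rw [dist_comm (P.center w) (P.point b'), P.dist_point_center hw hb'] at h2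
  linarith

theorem faceDist_point {f : F} {b : B} (hb : b ∈ D.blacks f) :
    P.faceDist f (P.point b) = 0 := by
  rw [P.faceDist_eq_of_le hb fun b' _ => by simp, dist_self]

/-- The functions `faceDist` of the faces fit together on the intersections of the kites. -/
theorem faceDist_eq_faceDist {f g : F} {z : ℂ} (hf : z ∈ P.kite f) (hg : z ∈ P.kite g) :
    P.faceDist f z = P.faceDist g z := by
  by_cases hfg : f = g
  · rw [hfg]
  have hz : z ∈ P.kite f ∩ P.kite g := ⟨hf, hg⟩
  simp only [kite] at hz
  rw [P.inter_eq f g hfg] at hz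
  have hW : (D.whites f ∩ D.whites g).Subsingleton := D.white_regular f g hfg
  have hB : (D.blacks f ∩ D.blacks g).Subsingleton := D.black_regular f g hfg
  rcases hW.eq_empty_or_singleton with hW | ⟨w, hW⟩ <;>
    rcases hB.eq_empty_or_singleton with hB | ⟨b, hB⟩ <;> rw [hW, hB] at hz
  · simp at hz
  · have hb : b ∈ D.blacks f ∩ D.blacks g := hB ▸ rfl
    simp only [Set.image_empty, Set.empty_union, Set.image_singleton, convexHull_singleton,
      Set.mem_singleton_iff] at hz
    rw [hz, P.faceDist_point hb.1, P.faceDist_point hb.2]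
  · have hw : w ∈ D.whites f ∩ D.whites g := hW ▸ rfl
    simp only [Set.image_empty, Set.union_empty, Set.image_singleton, convexHull_singleton,
      Set.mem_singleton_iff] at hz
    rw [hz, P.faceDist_center hw.1, P.faceDist_center hw.2]
  · have hb : b ∈ D.blacks f ∩ D.blacks g := hB ▸ rfl
    have hw : w ∈ D.whites f ∩ D.whites g := hW ▸ rfl
    rw [Set.image_singleton, Set.image_singleton, Set.singleton_union, convexHull_pair] at hz
    rw [P.faceDist_of_mem_segment hw.1 hb.1 hz, P.faceDist_of_mem_segment hw.2 hb.2 hz]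

variable {P}

theorem IsLocallyFinite.locallyFinite (hfin : P.IsLocallyFinite) : LocallyFinite P.kite := fun z =>
  ⟨Metric.closedBall z 1, Metric.closedBall_mem_nhds z one_pos, hfin _ (isCompact_closedBall z 1)⟩

/-- The radii of a locally finite pattern that covers the plane depend on the centres in a
Lipschitz way, so that they grow at most linearly. -/
theorem exists_radius_le (hcover : P.CoversPlane) (hfin : P.IsLocallyFinite) :
    ∃ R₀ : ℝ, ∀ w, P.radius w ≤ R₀ + ‖P.center w‖ := by
  have hex : ∀ z, ∃ f, z ∈ P.kite f := fun z => Set.mem_iUnion.1 (hcover ▸ Set.mem_univ z)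
  choose F₀ hF₀ using hex
  let g : ℂ → ℝ := fun z => P.faceDist (F₀ z) z
  have hg : ∀ f, ∀ z ∈ P.kite f, g z = P.faceDist f z := fun f z hz =>
    P.faceDist_eq_faceDist (hF₀ z) hz
  have hlip : LipschitzWith 1 g := LipschitzWith.of_locallyFinite_cover hfin.locallyFinite
    P.isClosed_kite hcover fun f z hz w hw => by
      rw [hg f z hz, hg f w hw]
      exact P.lipschitzWith_faceDist f z w
  refine ⟨g 0, fun w => ?_⟩
  obtain ⟨f, hf⟩ := exists_mem_whites (D := D) w
  have h1 : g (P.center w) = P.radius w := by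
    rw [hg f _ (P.center_mem_kite hf), P.faceDist_center hf]
  have h2 := hlip.dist_le_mul (P.center w) 0
  rw [h1, Real.dist_eq] at h2
  simp only [NNReal.coe_one, one_mul, dist_zero_right] at h2
  linarith [le_abs_self (P.radius w - g 0)]

theorem IsLocallyFinite.finite_setOf_mem_whites (hfin : P.IsLocallyFinite) (w : W) :
    {f | w ∈ D.whites f}.Finite :=
  (hfin {P.center w} isCompact_singleton).subset fun _ hf =>
    ⟨P.center w, P.center_mem_kite hf, rfl⟩

theorem IsLocallyFinite.finite_setOf_norm_center_le (hfin : P.IsLocallyFinite) (R : ℝ) :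
    {w | ‖P.center w‖ ≤ R}.Finite := by
  have h := hfin _ (isCompact_closedBall 0 R)
  refine ((h.image D.white₁).union (h.image D.white₂)).subset fun w hw => ?_
  obtain ⟨f, hf⟩ := exists_mem_whites (D := D) w
  have hf' : f ∈ {f | (P.kite f ∩ Metric.closedBall 0 R).Nonempty} :=
    ⟨P.center w, P.center_mem_kite hf, by simpa using hw⟩
  rcases hf with hf | hf
  · exact Or.inl ⟨f, hf', hf.symm⟩
  · exact Or.inr ⟨f, hf', hf.symm⟩

/-! ### Conductances in terms of the geometry of the kites. -/

variable (P)

/-- The conductance of the edge of `G` given by a face. -/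
def weight (f : F) : ℝ :=
  2 * (P.radius (D.white₁ f) * P.radius (D.white₂ f) * Real.sin (α f)) /
    dist (P.center (D.white₁ f)) (P.center (D.white₂ f)) ^ 2

variable {P}

theorem dist_center_sq (f : F) :
    dist (P.center (D.white₁ f)) (P.center (D.white₂ f)) ^ 2 =
      P.radius (D.white₁ f) ^ 2 + P.radius (D.white₂ f) ^ 2 -
        2 * P.radius (D.white₁ f) * P.radius (D.white₂ f) * Real.cos (α f) := by
  have h := EuclideanGeometry.dist_sq_eq_dist_sq_add_dist_sq_sub_two_mul_dist_mul_dist_mul_cos_angle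
    (P.center (D.white₁ f)) (P.point (D.black₁ f)) (P.center (D.white₂ f))
  rw [P.angle_eq f _ (black₁_mem f), dist_comm _ (P.point _), dist_comm _ (P.point _),
    P.dist_point_center (white₁_mem f) (black₁_mem f),
    P.dist_point_center (white₂_mem f) (black₁_mem f)] at h
  linarith

theorem dist_center_pos (hα : D.IsAdmissible α) (f : F) :
    0 < dist (P.center (D.white₁ f)) (P.center (D.white₂ f)) := by
  have h := P.dist_center_sq f
  have h1 := P.radius_pos (D.white₁ f)
  have h2 := P.radius_pos (D.white₂ f)
  have h3 : Real.cos (α f) < 1 := by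
    rw [← Real.cos_zero]
    exact Real.cos_lt_cos_of_nonneg_of_le_pi le_rfl (hα.lt_pi f).le (hα.pos f)
  have h4 : 0 < P.radius (D.white₁ f) * P.radius (D.white₂ f) * (1 - Real.cos (α f)) :=
    mul_pos (mul_pos h1 h2) (by linarith)
  refine lt_of_le_of_ne dist_nonneg fun h0 => ?_
  rw [← h0] at h
  nlinarith [sq_nonneg (P.radius (D.white₁ f) - P.radius (D.white₂ f))]

theorem weight_pos (hα : D.IsAdmissible α) (f : F) : 0 < P.weight f := by
  have h1 := P.radius_pos (D.white₁ f)
  have h2 := P.radius_pos (D.white₂ f)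
  have h3 := Real.sin_pos_of_pos_of_lt_pi (hα.pos f) (hα.lt_pi f)
  have h4 := P.dist_center_pos hα f
  unfold weight
  positivity

/-- The denominator is the squared distance of the centres by the law of cosines, `dist_center_sq`.
-/
theorem two_mul_deriv_halfAngle {θ r s : ℝ} (h0 : 0 < θ) (hpi : θ < Real.pi) (hr : 0 < r)
    (hs : 0 < s) : 2 * deriv (halfAngle θ) (Real.log s - Real.log r) =
      2 * (r * s * Real.sin θ) / (r ^ 2 + s ^ 2 - 2 * r * s * Real.cos θ) := by
  rw [(hasDerivAt_halfAngle h0 hpi _).deriv, Real.exp_sub, Real.exp_log hr, Real.exp_log hs,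
    mul_div_assoc 2 (r * s * Real.sin θ)]
  congr 1
  rw [← mul_div_mul_left _ _ (pow_ne_zero 2 hr.ne')]
  congr 1
  · field_simp
  · field_simp
    ring

theorem conductance_eq (hα : D.IsAdmissible α) (x y : W) :
    P.conductance x y = ∑' f : {f : F // D.Joins f x y}, ENNReal.ofReal (P.weight f) := by
  refine tsum_congr fun ⟨f, hf⟩ => ?_
  rw [two_mul_deriv_halfAngle (hα.pos f) (hα.lt_pi f) (P.radius_pos _) (P.radius_pos _), weight,
    P.dist_center_sq f]
  rcases hf with ⟨rfl, rfl⟩ | ⟨rfl, rfl⟩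
  · rfl
  · congr 2 <;> ring

theorem joins_comm {f : F} {x y : W} : D.Joins f x y ↔ D.Joins f y x := by
  unfold BQuadGraph.Joins
  tauto

theorem left_mem_of_joins {f : F} {x y : W} (h : D.Joins f x y) : x ∈ D.whites f :=
  h.imp And.left And.left

theorem conductance_comm (hα : D.IsAdmissible α) (x y : W) :
    P.conductance x y = P.conductance y x := by
  simp only [conductance_eq hα]
  have h : {f | D.Joins f x y} = {f | D.Joins f y x} := Set.ext fun f => joins_comm
  exact congrArg (fun s : Set F => ∑' f : s, ENNReal.ofReal (P.weight f)) h

theorem conductance_ne_top (hα : D.IsAdmissible α) (hfin : P.IsLocallyFinite) (x y : W) :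
    P.conductance x y ≠ ∞ := by
  have : Finite {f : F // D.Joins f x y} :=
    ((hfin.finite_setOf_mem_whites x).subset fun _ hf => left_mem_of_joins hf).to_subtype
  have := Fintype.ofFinite {f : F // D.Joins f x y}
  rw [conductance_eq hα, tsum_fintype]
  exact ENNReal.sum_ne_top.2 fun _ _ => ENNReal.ofReal_ne_top

theorem exists_joins_of_conductance_ne_zero {x y : W} (h : P.conductance x y ≠ 0) :
    ∃ f, D.Joins f x y := by
  by_contra! h'
  have : IsEmpty {f : F // D.Joins f x y} := ⟨fun f => h' f.1 f.2⟩
  exact h tsum_empty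

theorem finite_setOf_conductance_ne_zero (hfin : P.IsLocallyFinite) (x : W) :
    {y | P.conductance x y ≠ 0}.Finite := by
  have h := hfin.finite_setOf_mem_whites x
  refine ((h.image D.white₁).union (h.image D.white₂)).subset fun y hy => ?_
  obtain ⟨f, hf⟩ := exists_joins_of_conductance_ne_zero hy
  have hx : f ∈ {f | x ∈ D.whites f} := left_mem_of_joins hf
  rcases hf with hf | hf
  · exact Or.inr ⟨f, hx, hf.2.symm⟩
  · exact Or.inl ⟨f, hx, hf.2.symm⟩

theorem exists_conductance_ne_zero (hα : D.IsAdmissible α) (x : W) :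
    ∃ y, P.conductance x y ≠ 0 := by
  obtain ⟨f, hf⟩ := exists_mem_whites (D := D) x
  obtain ⟨y, hy⟩ : ∃ y, D.Joins f x y := by
    rcases hf with hf | hf
    · exact ⟨_, Or.inl ⟨hf, rfl⟩⟩
    · exact ⟨_, Or.inr ⟨hf, rfl⟩⟩
  refine ⟨y, fun h => ?_⟩
  rw [conductance_eq hα, ENNReal.tsum_eq_zero] at h
  have h0 := h ⟨f, hy⟩
  rw [ENNReal.ofReal_eq_zero] at h0
  exact absurd (P.weight_pos hα f) (not_lt.2 h0)

-- The factor 2 arises because `Network.energy` sums over ordered pairs, and a face joins its white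
-- vertices in both orders.
open Classical in
theorem energy_conductance_le (hα : D.IsAdmissible α) (φ : W → ℝ) :
    Network.energy P.conductance φ ≤
      2 * ∑' f, ENNReal.ofReal (P.weight f * (φ (D.white₁ f) - φ (D.white₂ f)) ^ 2) := by
  have h1 : ∀ x y, P.conductance x y * ENNReal.ofReal ((φ x - φ y) ^ 2) =
      ∑' f, if D.Joins f x y then
        ENNReal.ofReal (P.weight f * (φ (D.white₁ f) - φ (D.white₂ f)) ^ 2) else 0 := by
    intro x y
    rw [conductance_eq hα, ← ENNReal.tsum_mul_right]
    rw [← tsum_subtype_eq_of_support_subset (s := {f | D.Joins f x y})]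
    · refine tsum_congr fun ⟨f, hf⟩ => ?_
      have hf' : D.Joins f x y := hf
      rw [if_pos hf', ENNReal.ofReal_mul (P.weight_pos hα f).le]
      rcases hf' with ⟨rfl, rfl⟩ | ⟨rfl, rfl⟩
      · rfl
      · rw [← neg_sq, neg_sub]
    · intro f hf
      by_contra hf'
      exact hf (if_neg hf')
  simp only [Network.energy, h1]
  rw [← ENNReal.tsum_mul_left]
  have h2 : ∀ x, ∑' y, ∑' f, (if D.Joins f x y then
        ENNReal.ofReal (P.weight f * (φ (D.white₁ f) - φ (D.white₂ f)) ^ 2) else 0) =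
      ∑' f, ∑' y, (if D.Joins f x y then
        ENNReal.ofReal (P.weight f * (φ (D.white₁ f) - φ (D.white₂ f)) ^ 2) else 0) :=
    fun x => ENNReal.tsum_comm
  simp only [h2]
  rw [ENNReal.tsum_comm]
  refine ENNReal.tsum_le_tsum fun f => ?_
  generalize ENNReal.ofReal (P.weight f * (φ (D.white₁ f) - φ (D.white₂ f)) ^ 2) = a
  have h3 : ∀ u v : W, ∑' x, ∑' y, (if x = u then if y = v then a else 0 else 0) = a := by
    intro u v
    rw [tsum_eq_single u fun x hx => by simp [hx]]
    simp
  calc ∑' x, ∑' y, (if D.Joins f x y then a else 0)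
      ≤ ∑' x, ∑' y, ((if x = D.white₁ f then if y = D.white₂ f then a else 0 else 0) +
          (if x = D.white₂ f then if y = D.white₁ f then a else 0 else 0)) := by
        refine ENNReal.tsum_le_tsum fun x => ENNReal.tsum_le_tsum fun y => ?_
        by_cases h : D.Joins f x y
        · rw [if_pos h]
          rcases h with ⟨hx, hy⟩ | ⟨hx, hy⟩
          · rw [if_pos hx, if_pos hy]
            exact le_self_add
          · rw [if_pos hx, if_pos hy]
            exact le_add_self
        · rw [if_neg h]
          exact bot_le
    _ = 2 * a := by
        simp only [ENNReal.tsum_add, h3]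
        rw [two_mul]

/-! ### Cutoff functions and the uniform energy bound. -/

/-- The cutoff function that is `1` at the vertices with centre in the disc of radius `R` and
vanishes at those with centre outside the disc of radius `2R`. -/
def cutoff (P : EmbeddedCirclePattern D α) (R : ℝ) (w : W) : ℝ :=
  max 0 (min 1 (2 - ‖P.center w‖ / R))

theorem cutoff_eq_one {R : ℝ} (hR : 0 < R) {w : W} (h : ‖P.center w‖ ≤ R) :
    P.cutoff R w = 1 := by
  have h1 : ‖P.center w‖ / R ≤ 1 := (div_le_one hR).2 h
  rw [cutoff, min_eq_left (by linarith), max_eq_right zero_le_one]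

theorem cutoff_eq_zero {R : ℝ} (hR : 0 < R) {w : W} (h : 2 * R ≤ ‖P.center w‖) :
    P.cutoff R w = 0 := by
  have h1 : 2 ≤ ‖P.center w‖ / R := (le_div_iff₀ hR).2 h
  rw [cutoff]
  exact max_eq_left ((min_le_right _ _).trans (by linarith))

/-- The cutoff takes values in `[0, 1]` and is `1/R`-Lipschitz in the centre; the first bound serves
edges longer than `R`, the second the others. -/
theorem sq_cutoff_sub_mul_le {R : ℝ} (hR : 0 < R) (v w : W) :
    (P.cutoff R v - P.cutoff R w) ^ 2 * max (dist (P.center v) (P.center w)) R ^ 2 ≤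
      dist (P.center v) (P.center w) ^ 2 := by
  set l := dist (P.center v) (P.center w) with hl
  have hl0 : 0 ≤ l := dist_nonneg
  have hb : ∀ u, 0 ≤ P.cutoff R u ∧ P.cutoff R u ≤ 1 := fun u =>
    ⟨le_max_left _ _, max_le zero_le_one (min_le_left _ _)⟩
  have h1 : |P.cutoff R v - P.cutoff R w| ≤ 1 :=
    abs_le.2 ⟨by linarith [hb v, hb w], by linarith [hb v, hb w]⟩
  have h2 : |P.cutoff R v - P.cutoff R w| * R ≤ l := by
    rw [← le_div_iff₀ hR]
    have h3 : |P.cutoff R v - P.cutoff R w| ≤ |‖P.center v‖ / R - ‖P.center w‖ / R| := by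
      unfold cutoff
      rw [abs_sub_comm (‖P.center v‖ / R)]
      refine (abs_max_sub_max_le_max _ _ _ _).trans ?_
      rw [sub_self, abs_zero, max_eq_right (abs_nonneg _)]
      refine (abs_min_sub_min_le_max _ _ _ _).trans ?_
      rw [sub_self, abs_zero, max_eq_right (abs_nonneg _)]
      refine le_of_eq (congrArg abs ?_)
      ring
    refine h3.trans ?_
    rw [← sub_div, abs_div, abs_of_pos hR]
    gcongr
    rw [hl, dist_eq_norm]
    exact abs_norm_sub_norm_le _ _
  rw [← sq_abs, ← mul_pow]
  refine pow_le_pow_left₀ (by positivity) ?_ 2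
  rcases max_choice l R with h | h <;> rw [h]
  · exact mul_le_of_le_one_left hl0 h1
  · exact h2

theorem weight_eq_crossProd {f : F} {v w : W} (h : D.Joins f v w) :
    P.weight f = 2 * |crossProd (P.center w - P.center v) (P.point (D.black₁ f) - P.center v)| /
      dist (P.center v) (P.center w) ^ 2 := by
  have h1 := P.angle_eq f _ (black₁_mem f)
  rw [abs_crossProd_sub_sub, weight]
  rcases h with ⟨rfl, rfl⟩ | ⟨rfl, rfl⟩
  · rw [h1, P.dist_point_center (white₁_mem f) (black₁_mem f),
      P.dist_point_center (white₂_mem f) (black₁_mem f)]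
  · rw [EuclideanGeometry.angle_comm, h1, P.dist_point_center (white₁_mem f) (black₁_mem f),
      P.dist_point_center (white₂_mem f) (black₁_mem f), dist_comm (P.center (D.white₁ f))]
    ring

theorem convexHull_subset_kite {f : F} {v w : W} (h : D.Joins f v w) :
    convexHull ℝ {P.center v, P.center w, P.point (D.black₁ f)} ⊆ P.kite f := by
  rcases h with ⟨rfl, rfl⟩ | ⟨rfl, rfl⟩
  · exact Set.subset_union_left
  · rw [Set.insert_comm]
    exact Set.subset_union_left

theorem exists_isOpen_subset_kite (hα : D.IsAdmissible α) {R : ℝ} (hR : 0 < R)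
    (hr : ∀ w, P.radius w ≤ R + ‖P.center w‖) (f : F) :
    ∃ A : Set ℂ, IsOpen A ∧ A ⊆ P.kite f ∧ A ⊆ Metric.ball 0 (4 * R) ∧
      ENNReal.ofReal (P.weight f *
        (P.cutoff R (D.white₁ f) - P.cutoff R (D.white₂ f)) ^ 2) ≤
        ENNReal.ofReal (8 / R ^ 2) * volume A := by
  have key : ∀ v w, D.Joins f v w → ‖P.center v‖ < 2 * R → ∃ A : Set ℂ, IsOpen A ∧ A ⊆ P.kite f ∧
      A ⊆ Metric.ball 0 (4 * R) ∧ ENNReal.ofReal (P.weight f *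
        (P.cutoff R v - P.cutoff R w) ^ 2) ≤ ENNReal.ofReal (8 / R ^ 2) * volume A := by
    intro v w hj hv
    have hl : 0 < dist (P.center v) (P.center w) := by
      have := P.dist_center_pos hα f
      rcases hj with ⟨rfl, rfl⟩ | ⟨rfl, rfl⟩
      · exact this
      · rwa [dist_comm]
    obtain ⟨A, hA, hAk, hAb, hvol⟩ := exists_isOpen_subset_triangle (c₁ := P.center w)
      (p := P.point (D.black₁ f)) hR hv (by
        rw [P.dist_point_center (left_mem_of_joins hj) (black₁_mem f)]
        linarith [hr v])
    refine ⟨A, hA, hAk.trans (convexHull_subset_kite hj), hAb, ?_⟩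
    rw [hvol, ← ENNReal.ofReal_mul (by positivity)]
    refine ENNReal.ofReal_le_ofReal ?_
    have hcut := P.sq_cutoff_sub_mul_le hR v w
    rw [weight_eq_crossProd hj]
    generalize |crossProd (P.center w - P.center v) (P.point (D.black₁ f) - P.center v)| = d,
      abs_nonneg (crossProd (P.center w - P.center v)
        (P.point (D.black₁ f) - P.center v)) = hd at *
    have hm : 0 < max (dist (P.center v) (P.center w)) R := lt_max_of_lt_right hR
    generalize max (dist (P.center v) (P.center w)) R = m at *
    have h8 : 8 / R ^ 2 * (R ^ 2 / (4 * m ^ 2) * d) = 2 * d / m ^ 2 := by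
      field_simp
      ring
    rw [h8, le_div_iff₀ (by positivity)]
    calc _ = 2 * d / dist (P.center v) (P.center w) ^ 2 *
          ((P.cutoff R v - P.cutoff R w) ^ 2 * m ^ 2) := by ring
      _ ≤ 2 * d / dist (P.center v) (P.center w) ^ 2 *
          dist (P.center v) (P.center w) ^ 2 := by gcongr
      _ = 2 * d := by field_simp
  -- The piece is taken at a centre within `2R` of the origin; if there is none, both cutoff values
  -- vanish and the empty set serves.
  rcases lt_or_ge ‖P.center (D.white₁ f)‖ (2 * R) with h₁ | h₁
  · exact key _ _ (Or.inl ⟨rfl, rfl⟩) h₁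
  rcases lt_or_ge ‖P.center (D.white₂ f)‖ (2 * R) with h₂ | h₂
  · obtain ⟨A, hA, hAk, hAb, h⟩ := key _ _ (Or.inr ⟨rfl, rfl⟩) h₂
    refine ⟨A, hA, hAk, hAb, ?_⟩
    rwa [← neg_sub, neg_sq]
  · exact ⟨∅, isOpen_empty, Set.empty_subset _, Set.empty_subset _, by
      simp [cutoff_eq_zero hR h₁, cutoff_eq_zero hR h₂]⟩

/-- The energy of the cutoff functions is bounded independently of the scale. -/
theorem energy_cutoff_le (hα : D.IsAdmissible α) {R : ℝ} (hR : 0 < R)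
    (hr : ∀ w, P.radius w ≤ R + ‖P.center w‖) :
    Network.energy P.conductance (P.cutoff R) ≤ ENNReal.ofReal (256 * Real.pi) := by
  choose A hA hAk hAb hvol using exists_isOpen_subset_kite hα hR hr
  have hdisj : Pairwise (Function.onFun Disjoint A) := fun f g hfg =>
    (P.disjoint_interior f g hfg).mono ((hA f).subset_interior_iff.2 (hAk f))
      ((hA g).subset_interior_iff.2 (hAk g))
  calc Network.energy P.conductance (P.cutoff R)
      ≤ 2 * ∑' f, ENNReal.ofReal (8 / R ^ 2) * volume (A f) :=
        (energy_conductance_le hα _).trans (mul_le_mul_right (ENNReal.tsum_le_tsum hvol) 2)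
    _ ≤ 2 * (ENNReal.ofReal (8 / R ^ 2) * volume (Metric.ball (0 : ℂ) (4 * R))) := by
        rw [ENNReal.tsum_mul_left]
        gcongr
        exact (tsum_meas_le_meas_iUnion_of_disjoint volume (fun f => (hA f).measurableSet)
          hdisj).trans (measure_mono (Set.iUnion_subset hAb))
    -- `2 · 8/R² · π(4R)² = 256π`.
    _ = ENNReal.ofReal (256 * Real.pi) := by
        have h2 : (2 : ℝ≥0∞) = ENNReal.ofReal 2 := by simp
        have hpi : (NNReal.pi : ℝ≥0∞) = ENNReal.ofReal Real.pi := by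
          rw [← NNReal.coe_real_pi, ENNReal.ofReal_coe_nnreal]
        rw [Complex.volume_ball, h2, hpi, ← ENNReal.ofReal_pow (by positivity),
          ← ENNReal.ofReal_mul (by positivity), ← ENNReal.ofReal_mul (by positivity),
          ← ENNReal.ofReal_mul (by positivity)]
        congr 1
        field_simp
        norm_num

theorem isRecurrent_conductance (hα : D.IsAdmissible α) (hcover : P.CoversPlane)
    (hfin : P.IsLocallyFinite) : Network.IsRecurrent P.conductance := by
  obtain ⟨R₀, hR₀⟩ := exists_radius_le hcover hfin
  refine Network.isRecurrent_of_forall_finite_exists_energy_le (conductance_comm hα)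
    (conductance_ne_top hα hfin) (finite_setOf_conductance_ne_zero hfin)
    (exists_conductance_ne_zero hα) (C := 256 * Real.pi) (by positivity) fun S hS => ?_
  obtain ⟨M, hM⟩ := (hS.image fun w => ‖P.center w‖).bddAbove
  -- `R ≥ R₀` yields the bound on the radii, and `R ≥ M` makes the cutoff 1 on `S`.
  set R := max 1 (max R₀ M) with hRdef
  have hR : 0 < R := zero_lt_one.trans_le (le_max_left _ _)
  have h0 : R₀ ≤ R := (le_max_left _ _).trans (le_max_right _ _)
  have h1 : M ≤ R := (le_max_right _ _).trans (le_max_right _ _)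
  refine ⟨P.cutoff R, (hfin.finite_setOf_norm_center_le (2 * R)).subset fun w hw => ?_,
    fun w hw => cutoff_eq_one hR ((hM ⟨w, hw, rfl⟩).trans h1),
    energy_cutoff_le hα hR fun w => by linarith [hR₀ w]⟩
  by_contra h
  exact hw (cutoff_eq_zero hR (not_le.1 h).le)

end EmbeddedCirclePattern

end

theorem lemma4p3 {W B F : Type*} (D : BQuadGraph W B F) (α : F → ℝ) (hα : D.IsAdmissible α)
    (P : EmbeddedCirclePattern D α) (hcover : P.CoversPlane) (hfin : P.IsLocallyFinite) :
    Network.IsRecurrent P.conductance :=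
  EmbeddedCirclePattern.isRecurrent_conductance hα hcover hfin
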